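/- Let $n,T\in\mathbb{N}$, $T\ge 1$. Let $L_t:\mathbb{R}^n\times\mathbb{R}^n\to\mathbb{R}\cup\{+\infty\}$ ($t=1,\dots,T$) and $g:\mathbb{R}^n\to\mathbb{R}\cup\{+\infty\}$ be proper, convex and lower semicontinuous. Write $\Delta x_t=x_t-x_{t-1}$, and for $\tau\in\{0,\dots,T-1\}$ and $\xi\in\mathbb{R}^n$ let $$\vartheta_\tau(\xi)=\inf\Big\{\sum_{t=\tau+1}^{T}L_t(x_{t-1},\Delta x_t)+g(x_T)\ :\ x_\tau,\dots,x_T\in\mathbb{R}^n,\ x_\tau=\xi\Big\}.$$ For $\varphi:\mathbb{R}^n\to\mathbb{R}\cup\{\pm\infty\}$ let $\operatorname{dom}\varphi=\{x:\varphi(x)<+\infty\}$, let $\varphi^*(y)=\sup_x\{x\cdot y-\varphi(x)\}$, let $\partial\varphi(x)=\{y:\varphi(x)+y\cdot(z-x)\le\varphi(z)\ \forall z\in\mathbb{R}^n\}$ for $x\in\operatorname{dom}\varphi$, and $\partial\varphi(x)=\emptyset$ otherwise. The Hamiltonian is $H_t(x,p)=\sup_{v}\{p\cdot v-L_t(x,v)\}$,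 and its concave-convex subdifferential is $$\partial H_t(x,p)=\big[-\partial(-H_t(\cdot,p))(x)\big]\times\partial (H_t(x,\cdot))(p).$$ A discrete-time Hamiltonian trajectory on $\{\tau,\dots,T\}$ is a family $(x_t,p_t)_{t=\tau}^T$ in $\mathbb{R}^n\times\mathbb{R}^n$ such that $(-\Delta p_t,\Delta x_t)\in\partial H_t(x_{t-1},p_t)$ for all $t\in\{\tau+1,\dots,T\}$. Let $K_t(p,w)=\sup_{x,v}\{x\cdot w+v\cdot p-L_t(x,v)\}$ and $f(b)=g^*(-b)$. Put $\Gamma_L(t,x)=\{v: L_t(x,v)\in\mathbb{R}\}$, $X(t)=\{x:\Gamma_L(t,x)\ne\emptyset\}$, $\Gamma_K(t,p)=\{w: K_t(p+w,w)\in\mathbb{R}\}$, $P(t)=\{p:\Gamma_K(t,p)\neq\emptyset\}$, and let $\operatorname{ri}$ denote the relative interior. Consider the qualification conditions (H) there are $\bar x_0,\dots,\bar x_T\in\mathbb{R}^n$ with $\bar x_T\in\operatorname{ri}(\operatorname{dom} g)$, and $\bar x_{t-1}\in\operatorname{ri}X(t)$, $\Delta\bar x_t\in\operatorname{ri}\Gamma_L(t,\bar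 x_{t-1})$ for all $t\in\{1,\dots,T\}$; (H') there are $\bar p_0,\dots,\bar p_T\in\mathbb{R}^n$ with $\bar p_T\in\operatorname{ri}(\operatorname{dom} f)$, and $\bar p_{t-1}\in\operatorname{ri}P(t)$, $\Delta\bar p_t\in\operatorname{ri}\Gamma_K(t,\bar p_{t-1})$ for all $t\in\{1,\dots,T\}$. **Theorem (discrete-time characteristic method).** Let $\tau\in\{0,\dots,T-1\}$ and $\xi,\eta\in\mathbb{R}^n$. If there is a discrete-time Hamiltonian trajectory $(x_t,p_t)_{t=\tau}^T$ on $\{\tau,\dots,T\}$ with $(x_\tau,p_\tau)=(\xi,-\eta)$ that satisfies the transversality condition $-p_T\in\partial g(x_T)$, then $\eta\in\partial\vartheta_\tau(\xi)$. Conversely, if (H) and (H') hold and $\eta\in\partial\vartheta_\tau(\xi)$, then such a trajectory exists. -/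

import Mathlib

noncomputable section

namespace Bolza

/-- `ℝⁿ` with the Euclidean norm and inner product. -/
abbrev E (n : ℕ) : Type := EuclideanSpace ℝ (Fin n)

/-- The Euclidean inner product, as an extended real. -/
def dot {n : ℕ} (a b : E n) : EReal := ((inner ℝ a b : ℝ) : EReal)

/-- Effective domain. -/
def dom {X : Type*} (φ : X → EReal) : Set X := {x | φ x < ⊤}

/-- Epigraph, a subset of `X × ℝ`. -/
def epi {X : Type*} (φ : X → EReal) : Set (X × ℝ) := {q | φ q.1 ≤ (q.2 : EReal)}

/-- Proper: somewhere `< +∞`, and nowhere `-∞`. -/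
def IsProper {X : Type*} (φ : X → EReal) : Prop := (dom φ).Nonempty ∧ ∀ x, ⊥ < φ x

/-- Proper, convex (convex epigraph) and lower semicontinuous (closed epigraph). -/
structure IsProperConvexLsc {X : Type*} [AddCommGroup X] [Module ℝ X] [TopologicalSpace X]
    (φ : X → EReal) : Prop where
  proper : IsProper φ
  convex : Convex ℝ (epi φ)
  lsc : IsClosed (epi φ)

/-- The conjugate `φ*(y) = sup_x (x · y - φ x)`. -/
def conj {n : ℕ} (φ : E n → EReal) (y : E n) : EReal := ⨆ x : E n, (dot x y - φ x)

/-- The convex subdifferential; it is empty outside the effective domain. -/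
def subdiff {n : ℕ} (φ : E n → EReal) (x : E n) : Set (E n) :=
  {y | x ∈ dom φ ∧ ∀ z : E n, φ x + dot y (z - x) ≤ φ z}

/-- The concave-convex subdifferential `[-∂(-h(·, y))(x)] × ∂(h(x, ·))(y)`. -/
def saddleSubdiff {n : ℕ} (h : E n → E n → EReal) (x y : E n) : Set (E n × E n) :=
  {q | -q.1 ∈ subdiff (fun x' => -h x' y) x ∧ q.2 ∈ subdiff (fun y' => h x y') y}

/-- The backward difference `Δx_t = x_t - x_{t-1}`; it is used only for `t ≥ 1`. -/
def diff {n : ℕ} (x : ℕ → E n) (t : ℕ) : E n := x t - x (t - 1)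

/-- The standing assumption on the data: each `L_t`, `1 ≤ t ≤ T`, is proper, convex and l.s.c.
jointly in its two arguments, and so is `g`. -/
structure FullyConvex {n : ℕ} (T : ℕ) (L : ℕ → E n → E n → EReal) (g : E n → EReal) : Prop where
  lagrangian : ∀ t ∈ Finset.Icc 1 T,
    IsProperConvexLsc (fun q : E n × E n => L t q.1 q.2)
  terminal : IsProperConvexLsc g

/-- The cost `∑_{t=τ+1}^T L_t(x_{t-1}, Δx_t) + g(x_T)`; it only involves `x_τ, …, x_T`. -/
def cost {n : ℕ} (T : ℕ) (L : ℕ → E n → E n → EReal) (g : E n → EReal) (τ : ℕ)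
    (x : ℕ → E n) : EReal :=
  (∑ t ∈ Finset.Icc (τ + 1) T, L t (x (t - 1)) (diff x t)) + g (x T)

/-- The value function `ϑ_τ(ξ)`: infimum of the cost over arcs that start at `ξ` at time `τ`. -/
def value {n : ℕ} (T : ℕ) (L : ℕ → E n → E n → EReal) (g : E n → EReal) (τ : ℕ)
    (ξ : E n) : EReal :=
  ⨅ (x : ℕ → E n) (_ : x τ = ξ), cost T L g τ x

/-- The Hamiltonian `H_t(x, p) = sup_v (p · v - L_t(x, v))`. -/
def hamiltonian {n : ℕ} (L : ℕ → E n → E n → EReal) (t : ℕ) (x p : E n) : EReal :=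
  ⨆ v : E n, (dot p v - L t x v)

/-- The dual Lagrangian `K_t(p, w) = sup_{x, v} (x · w + v · p - L_t(x, v))`. -/
def dualLagrangian {n : ℕ} (L : ℕ → E n → E n → EReal) (t : ℕ) (p w : E n) : EReal :=
  ⨆ (x : E n) (v : E n), (dot x w + dot v p - L t x v)

/-- The dual terminal cost `f(b) = g*(-b)`. -/
def dualTerminal {n : ℕ} (g : E n → EReal) (b : E n) : EReal := conj g (-b)

/-- `Γ_L(t, x)`: the velocities at which `L_t(x, ·)` is a real number. -/
def primalDynamics {n : ℕ} (L : ℕ → E n → E n → EReal) (t : ℕ) (x : E n) : Set (E n) :=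
  {v | ∃ r : ℝ, L t x v = (r : EReal)}

/-- The state constraint set `{x | Γ_L(t, x) ≠ ∅}`. -/
def primalStates {n : ℕ} (L : ℕ → E n → E n → EReal) (t : ℕ) : Set (E n) :=
  {x | (primalDynamics L t x).Nonempty}

/-- `Γ_K(t, p)`: the `w` for which `K_t(p + w, w)` is a real number. -/
def dualDynamics {n : ℕ} (L : ℕ → E n → E n → EReal) (t : ℕ) (p : E n) : Set (E n) :=
  {w | ∃ r : ℝ, dualLagrangian L t (p + w) w = (r : EReal)}

/-- The dual state constraint set `{p | Γ_K(t, p) ≠ ∅}`. -/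
def dualStates {n : ℕ} (L : ℕ → E n → E n → EReal) (t : ℕ) : Set (E n) :=
  {p | (dualDynamics L t p).Nonempty}

/-- The primal qualification condition; `intrinsicInterior ℝ` is the relative interior. -/
def PrimalQualification {n : ℕ} (T : ℕ) (L : ℕ → E n → E n → EReal) (g : E n → EReal) : Prop :=
  ∃ x : ℕ → E n, x T ∈ intrinsicInterior ℝ (dom g) ∧
    ∀ t ∈ Finset.Icc 1 T, x (t - 1) ∈ intrinsicInterior ℝ (primalStates L t) ∧
      diff x t ∈ intrinsicInterior ℝ (primalDynamics L t (x (t - 1)))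

/-- The dual qualification condition. -/
def DualQualification {n : ℕ} (T : ℕ) (L : ℕ → E n → E n → EReal) (g : E n → EReal) : Prop :=
  ∃ p : ℕ → E n, p T ∈ intrinsicInterior ℝ (dom (dualTerminal g)) ∧
    ∀ t ∈ Finset.Icc 1 T, p (t - 1) ∈ intrinsicInterior ℝ (dualStates L t) ∧
      diff p t ∈ intrinsicInterior ℝ (dualDynamics L t (p (t - 1)))

/-- `(x_t, p_t)`, `τ ≤ t ≤ T`, is a discrete-time Hamiltonian trajectory:
`(-Δp_t, Δx_t) ∈ ∂H_t(x_{t-1}, p_t)` for `τ + 1 ≤ t ≤ T`. -/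
def IsHamiltonianTrajectory {n : ℕ} (T : ℕ) (L : ℕ → E n → E n → EReal) (τ : ℕ)
    (x p : ℕ → E n) : Prop :=
  ∀ t ∈ Finset.Icc (τ + 1) T,
    (-diff p t, diff x t) ∈ saddleSubdiff (hamiltonian L t) (x (t - 1)) (p t)

/-- There is a Hamiltonian trajectory on `[τ : T]` from `(ξ, -η)` that satisfies the
transversality condition `-p_T ∈ ∂g(x_T)`. -/
def HasCharacteristic {n : ℕ} (T : ℕ) (L : ℕ → E n → E n → EReal) (g : E n → EReal) (τ : ℕ)
    (ξ η : E n) : Prop :=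
  ∃ x p : ℕ → E n, IsHamiltonianTrajectory T L τ x p ∧ x τ = ξ ∧ p τ = -η ∧
    -p T ∈ subdiff g (x T)

end Bolza

end

/-! Conjugation in the velocity alone turns `(-Δp_t, Δx_t) ∈ ∂H_t(x_{t-1}, p_t)` into the statement
that `(Δp_t, p_t)` is a subgradient of `L_t` at `(x_{t-1}, Δx_t)`
(`mem_saddleSubdiff_hamiltonian_iff`). Summing these subgradient inequalities and the one for `g`,
the linear terms telescope by `sum_inner_diff` to `-p_τ · (y_τ - x_τ) = η · (y_τ - ξ)`, which gives
sufficiency.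

For the converse, `exists_multipliers` is a Lagrange multiplier theorem: the optimal value is convex
in a perturbation of the velocities, and qualification puts `0` in the relative core of its domain,
so it has a linear minorant. It is used twice. Applied to the dual problem under (H'), its
multipliers form an optimal primal arc `x`, because closed convex functions are suprema of their
affine minorants. Applied to the primal problem with initial cost `-η · y_τ` under (H), it yields
`p`. At `x` the decoupled Lagrangian attains its lower bound; varying one stage or the endpoint
alone gives the inclusions and transversality. -/

namespace Bolza

/-! ### Relative cores and linear minorants of convex functions. -/

/-- The algebraic relative interior: the points of `C` beyond which every segment of `C` ending
there can be prolonged. -/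
def relCore {V : Type*} [AddCommGroup V] [Module ℝ V] (C : Set V) : Set V :=
  {x | x ∈ C ∧ ∀ y ∈ C, ∃ ε : ℝ, 0 < ε ∧ x + ε • (x - y) ∈ C}

/-- The line through `x` and `y` stays in the affine span, so by continuity a short prolongation
beyond `x` stays in the relative neighbourhood of `x`. -/
theorem intrinsicInterior_subset_relCore {V : Type*} [NormedAddCommGroup V] [NormedSpace ℝ V]
    (C : Set V) : intrinsicInterior ℝ C ⊆ relCore C := by
  intro x hx
  refine ⟨intrinsicInterior_subset hx, fun y hy => ?_⟩
  obtain ⟨z, hz, rfl⟩ := mem_intrinsicInterior.1 hx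
  have hy' : y ∈ affineSpan ℝ C := subset_affineSpan ℝ C hy
  have hmem : ∀ ε : ℝ, (z : V) + ε • ((z : V) - y) ∈ affineSpan ℝ C := by
    intro ε
    have := AffineMap.lineMap_mem (-ε) z.2 hy'
    rw [AffineMap.lineMap_apply_module'] at this
    convert this using 1
    module
  let γ : ℝ → affineSpan ℝ C := fun ε => ⟨(z : V) + ε • ((z : V) - y), hmem ε⟩
  have hγ : Continuous γ := by
    apply Continuous.subtype_mk
    fun_prop
  have h0 : γ 0 = z := by
    apply Subtype.ext
    simp [γ]
  have hev : ∀ᶠ ε in nhds (0 : ℝ), γ ε ∈ interior ((↑) ⁻¹' C : Set (affineSpan ℝ C)) := by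
    apply hγ.continuousAt.eventually_mem
    rw [h0]
    exact isOpen_interior.mem_nhds hz
  obtain ⟨δ, hδ, hball⟩ := Metric.eventually_nhds_iff.1 hev
  refine ⟨δ / 2, half_pos hδ, ?_⟩
  have := hball (y := δ / 2) (by
    rw [Real.dist_eq, sub_zero, abs_of_pos (half_pos hδ)]
    linarith)
  have hC : γ (δ / 2) ∈ ((↑) ⁻¹' C : Set (affineSpan ℝ C)) := interior_subset this
  exact hC

/-- If the prolongation by `ε` stays in a convex set, so does every shorter one. -/
theorem relCore_shrink {V : Type*} [AddCommGroup V] [Module ℝ V] {C : Set V} (hC : Convex ℝ C)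
    {x y : V} (hx : x ∈ C) {ε δ : ℝ} (hδ : 0 < δ) (hδε : δ ≤ ε)
    (h : x + ε • (x - y) ∈ C) : x + δ • (x - y) ∈ C := by
  have hε : 0 < ε := hδ.trans_le hδε
  have hle : δ / ε ≤ 1 := (div_le_one hε).2 hδε
  have := hC hx h (a := 1 - δ / ε) (b := δ / ε) (by linarith) (by positivity) (by ring)
  convert this using 1
  rw [smul_add, smul_smul, div_mul_cancel₀ _ hε.ne.symm]
  module

/-- A point in the relative core of the projection, with its fibre part in the relative core of
the fibre, lies in the relative core of the total set. -/
theorem mk_mem_relCore {V W : Type*} [AddCommGroup V] [Module ℝ V] [AddCommGroup W] [Module ℝ W]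
    {C : Set (V × W)} (hC : Convex ℝ C) {x : V} {v : W}
    (hx : x ∈ relCore {x | ∃ v, (x, v) ∈ C}) (hv : v ∈ relCore {v | (x, v) ∈ C}) :
    (x, v) ∈ relCore C := by
  refine ⟨hv.1, ?_⟩
  rintro ⟨y, w⟩ hyw
  obtain ⟨ε, hε, w', hw'⟩ := hx.2 y ⟨w, hyw⟩
  -- The segment from the prolonged point over `x + ε • (x - y)` to `(y, w)` crosses the fibre over
  -- `x`.
  have hmid : (x, (1 / (1 + ε)) • w' + (ε / (1 + ε)) • w) ∈ C := by
    have := hC hw' hyw (a := 1 / (1 + ε)) (b := ε / (1 + ε)) (by positivity) (by positivity)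
      (by field_simp)
    convert this using 1
    refine Prod.ext ?_ rfl
    simp only [Prod.smul_mk, Prod.mk_add_mk]
    match_scalars <;> field_simp
    ring
  obtain ⟨δ, hδ, hd⟩ := hv.2 _ hmid
  -- Prolong in the fibre beyond `v`, then mix with the point above `x + ε • (x - y)` with the
  -- weights that cancel `w'`.
  refine ⟨ε * δ / (1 + ε + δ), by positivity, ?_⟩
  have := hC hd hw' (a := (1 + ε) / (1 + ε + δ)) (b := δ / (1 + ε + δ)) (by positivity)
    (by positivity) (by field_simp)
  convert this using 1
  refine Prod.ext ?_ ?_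
  · simp only [Prod.smul_mk, Prod.mk_add_mk, Prod.mk_sub_mk]
    match_scalars <;> field_simp
    ring
  · simp only [Prod.smul_mk, Prod.mk_add_mk, Prod.mk_sub_mk]
    match_scalars <;> field_simp <;> ring

/-- The cone generated by a convex set whose relative core contains the origin is a subspace. -/
def coneSpan {U : Type*} [AddCommGroup U] [Module ℝ U] {D : Set U} (hD : Convex ℝ D)
    (h0 : (0 : U) ∈ relCore D) : Submodule ℝ U where
  carrier := {u | ∃ c : ℝ, 0 < c ∧ ∃ d ∈ D, u = c • d}
  add_mem' := by
    rintro _ _ ⟨c, hc, d, hd, rfl⟩ ⟨c', hc', d', hd', rfl⟩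
    refine ⟨c + c', by positivity, _, hD hd hd' (a := c / (c + c')) (b := c' / (c + c'))
      (by positivity) (by positivity) (by field_simp), ?_⟩
    match_scalars <;> field_simp
  zero_mem' := ⟨1, one_pos, 0, h0.1, by simp⟩
  smul_mem' := by
    rintro a _ ⟨c, hc, d, hd, rfl⟩
    rcases lt_trichotomy a 0 with ha | rfl | ha
    · obtain ⟨ε, hε, h⟩ := h0.2 d hd
      refine ⟨-a * c / ε, by have := neg_pos.2 ha; positivity, _, h, ?_⟩
      match_scalars
      field_simp
    · exact ⟨1, one_pos, 0, h0.1, by simp⟩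
    · exact ⟨a * c, by positivity, d, hd, by rw [smul_smul]⟩

/-- A convex function that is bounded below by `m` at the origin, a point of the relative core of
its domain, has a linear minorant there. The function is given by its epigraph `G`. -/
theorem exists_linear_minorant {U : Type*} [AddCommGroup U] [Module ℝ U] {G : Set (U × ℝ)}
    (hG : Convex ℝ G) (h0 : (0 : U) ∈ relCore (Prod.fst '' G)) {m : ℝ}
    (hm : ∀ r, ((0 : U), r) ∈ G → m ≤ r) :
    ∃ ℓ : U →ₗ[ℝ] ℝ, ∀ q ∈ G, m + ℓ q.1 ≤ q.2 := by
  have hD : Convex ℝ (Prod.fst '' G) := hG.linear_image (LinearMap.fst ℝ U ℝ)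
  let W : Submodule ℝ U := coneSpan hD h0
  -- The cone generated by `G` lowered by `m`. The functional `(0, r) ↦ r` is nonnegative on it by
  -- `hm`; a positive extension `φ` gives `ℓ = -φ(·, 0)` on `W`.
  let s : PointedCone ℝ (W × ℝ) :=
    { carrier := {q | ∃ c : ℝ, 0 ≤ c ∧ ∃ d ∈ G, (q.1 : U) = c • d.1 ∧ q.2 = c * (d.2 - m)}
      smul_mem' := by
        rintro ⟨a, ha⟩ q ⟨c, hc, d, hd, h1, h2⟩
        refine ⟨a * c, by positivity, d, hd, ?_, ?_⟩
        · simp [h1, smul_smul, Nonneg.mk_smul]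
        · simp [h2, mul_assoc, Nonneg.mk_smul]
      zero_mem' := by
        obtain ⟨d, hd, -⟩ := h0.1
        exact ⟨0, le_rfl, d, hd, by simp, by simp⟩
      add_mem' := by
        rintro q q' ⟨c, hc, d, hd, h1, h2⟩ ⟨c', hc', d', hd', h1', h2'⟩
        rcases hc.eq_or_lt with rfl | hc
        · exact ⟨c', hc', d', hd', by simp [h1, h1'], by simp [h2, h2']⟩
        refine ⟨c + c', by positivity, _, hG hd hd' (a := c / (c + c')) (b := c' / (c + c'))
          (by positivity) (by positivity) (by field_simp), ?_, ?_⟩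
        · simp only [Prod.fst_add, Submodule.coe_add, h1, h1', Prod.smul_fst]
          match_scalars <;> field_simp
        · simp only [Prod.snd_add, h2, h2', Prod.smul_snd, smul_eq_mul]
          field_simp
          ring }
  let f : (W × ℝ) →ₗ.[ℝ] ℝ :=
    { domain := Submodule.prod ⊥ ⊤
      toFun := (LinearMap.snd ℝ W ℝ).comp (Submodule.subtype _) }
  obtain ⟨φ, hφf, hφs⟩ := riesz_extension s f
    (by
      rintro ⟨⟨w, r⟩, hw⟩ ⟨c, hc, d, hd, h1, h2⟩
      have hw0 : w = 0 := by simpa using hw.1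
      subst hw0
      have h2' : r = c * (d.2 - m) := h2
      change 0 ≤ r
      rcases hc.eq_or_lt with rfl | hc
      · simp [h2']
      have hd0 : d.1 = 0 := by
        have : c • d.1 = 0 := by simpa using h1.symm
        exact (smul_eq_zero.1 this).resolve_left hc.ne'
      have hle : m ≤ d.2 := hm d.2 (by rw [← hd0]; exact hd)
      rw [h2']
      exact mul_nonneg hc.le (sub_nonneg.2 hle))
    (by
      -- Every `w` in `W` is a positive multiple of a domain point, so a vertical shift moves `(w,
      -- a)` into the cone.
      rintro ⟨⟨w, c, hc, _, ⟨d, hd, rfl⟩, hw⟩, a⟩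
      refine ⟨⟨(0, c * (d.2 - m) - a), by simp [f]⟩, c, hc.le, d, hd, ?_, ?_⟩
      · simpa using hw
      · simp)
  obtain ⟨ℓ, hℓ⟩ := (-(φ.comp (LinearMap.inl ℝ W ℝ))).exists_extend
  refine ⟨ℓ, fun q hq => ?_⟩
  have hqW : q.1 ∈ W := ⟨1, one_pos, q.1, ⟨q, hq, rfl⟩, by simp⟩
  have h1 : ℓ q.1 = -φ (⟨q.1, hqW⟩, 0) := by
    have := LinearMap.congr_fun hℓ ⟨q.1, hqW⟩
    simpa using this
  have h2 : φ (0, q.2 - m) = q.2 - m :=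
    hφf ⟨(0, q.2 - m), by simp [f]⟩
  have h3 : 0 ≤ φ (⟨q.1, hqW⟩, q.2 - m) := hφs _ ⟨1, zero_le_one, q, hq, by simp, by simp⟩
  have h4 : φ (⟨q.1, hqW⟩, q.2 - m) = φ (⟨q.1, hqW⟩, 0) + φ (0, q.2 - m) := by
    rw [← map_add]
    simp
  linarith

/-! ### Affine minorants of closed convex functions. -/

/-- A proper convex lower semicontinuous function is the supremum of its continuous affine
minorants. -/
theorem IsProperConvexLsc.exists_affine_minorant {X : Type*} [NormedAddCommGroup X]
    [NormedSpace ℝ X] {φ : X → EReal} (hφ : IsProperConvexLsc φ) (x : X) {r : ℝ}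
    (hr : (r : EReal) < φ x) :
    ∃ (ℓ : X →L[ℝ] ℝ) (c : ℝ), r < ℓ x + c ∧ ∀ z (s : ℝ), φ z ≤ s → ℓ z + c ≤ s := by
  have sep : ∀ (x : X) (r : ℝ), (r : EReal) < φ x → ∃ (ℓ : X →L[ℝ] ℝ) (β u : ℝ),
      0 ≤ β ∧ ℓ x + β * r < u ∧ ∀ z (s : ℝ), φ z ≤ s → u < ℓ z + β * s := by
    intro x r hr
    obtain ⟨f, u, hfu, hf⟩ := geometric_hahn_banach_point_closed (x := (x, r)) hφ.convex hφ.lsc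
      (not_le.2 hr)
    have hdec : ∀ z (s : ℝ), f (z, s) = f.comp (ContinuousLinearMap.inl ℝ X ℝ) z + f (0, 1) * s := by
      intro z s
      have : ((z, s) : X × ℝ) = (z, 0) + s • (0, 1) := by simp
      rw [this, map_add, map_smul]
      simp [mul_comm]
    refine ⟨f.comp (ContinuousLinearMap.inl ℝ X ℝ), f (0, 1), u, ?_, ?_, ?_⟩
    · obtain ⟨z, hz⟩ := hφ.proper.1
      obtain ⟨s, hs, -⟩ := EReal.lt_iff_exists_real_btwn.1 hz
      by_contra hneg
      push Not at hneg
      obtain ⟨k, hk⟩ := exists_nat_gt ((f (z, s) - u) / -f (0, 1))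
      have h1 : u < f (z, s + k) := hf _ (by
        refine hs.le.trans ?_
        exact_mod_cast (le_add_of_nonneg_right (Nat.cast_nonneg k) : s ≤ s + (k : ℝ)))
      rw [div_lt_iff₀ (by linarith)] at hk
      rw [hdec] at h1
      rw [hdec] at hk
      nlinarith
    · rw [← hdec]
      exact hfu
    · intro z s hz
      rw [← hdec]
      exact hf _ hz
  have steep : ∀ (ℓ : X →L[ℝ] ℝ) (β u : ℝ) (x : X) (r : ℝ), 0 < β → ℓ x + β * r < u →
      (∀ z (s : ℝ), φ z ≤ s → u < ℓ z + β * s) →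
      ∃ (ℓ : X →L[ℝ] ℝ) (c : ℝ), r < ℓ x + c ∧ ∀ z (s : ℝ), φ z ≤ s → ℓ z + c ≤ s := by
    intro ℓ β u x r hβ h1 h2
    refine ⟨-(β⁻¹ • ℓ), u / β, ?_, fun z s hz => ?_⟩
    · simp only [neg_apply, smul_apply, smul_eq_mul]
      rw [inv_mul_eq_div, ← sub_eq_neg_add, ← sub_div, lt_div_iff₀ hβ]
      linarith
    · have := h2 z s hz
      simp only [neg_apply, smul_apply, smul_eq_mul]
      rw [inv_mul_eq_div, ← sub_eq_neg_add, ← sub_div, div_le_iff₀ hβ]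
      linarith
  obtain ⟨ℓ, β, u, hβ, h1, h2⟩ := sep x r hr
  rcases hβ.lt_or_eq with hβ | rfl
  · exact steep ℓ β u x r hβ h1 h2
  -- The hyperplane is vertical. Separation below a point of the domain is never vertical and gives
  -- some affine minorant; adding a large multiple of `u - ℓ`, negative on the domain and positive
  -- at `x`, lifts it above `r` at `x`.
  obtain ⟨x₁, hx₁⟩ := hφ.proper.1
  obtain ⟨r₁, -, hr₁⟩ := EReal.lt_iff_exists_real_btwn.1 (hφ.proper.2 x₁)
  obtain ⟨s₁, hs₁, -⟩ := EReal.lt_iff_exists_real_btwn.1 hx₁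
  obtain ⟨ℓ₁, β₁, u₁, hβ₁, h3, h4⟩ := sep x₁ r₁ hr₁
  have hβ₁' : 0 < β₁ := by
    rcases hβ₁.lt_or_eq with h | rfl
    · exact h
    · have := h4 x₁ s₁ hs₁.le
      linarith
  obtain ⟨ℓ₂, c, -, h5⟩ := steep ℓ₁ β₁ u₁ x₁ r₁ hβ₁' h3 h4
  obtain ⟨k, hk⟩ := exists_nat_gt ((r - ℓ₂ x - c) / (u - ℓ x))
  rw [div_lt_iff₀ (by linarith)] at hk
  refine ⟨ℓ₂ - (k : ℝ) • ℓ, c + k * u, ?_, fun z s hz => ?_⟩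
  · simp only [sub_apply, smul_apply, smul_eq_mul]
    linarith
  · have h6 := h5 z s hz
    have h7 := h2 z s hz
    have h8 : (k : ℝ) * u ≤ k * ℓ z := by
      apply mul_le_mul_of_nonneg_left _ (Nat.cast_nonneg k)
      linarith
    simp only [sub_apply, smul_apply, smul_eq_mul]
    linarith

/-! ### Summation by parts, and conjugates bounded through real numbers. -/

theorem exists_inner_eq {n : ℕ} (ℓ : E n →ₗ[ℝ] ℝ) : ∃ p : E n, ∀ u, ℓ u = inner ℝ p u :=
  ⟨(InnerProductSpace.toDual ℝ (E n)).symm (LinearMap.toContinuousLinearMap ℓ), fun u => by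
    rw [InnerProductSpace.toDual_symm_apply]
    rfl⟩

/-- The discrete product rule: each summand is `p_t · y_t - p_{t-1} · y_{t-1}`. -/
theorem sum_inner_diff {n : ℕ} (p y : ℕ → E n) {τ T : ℕ} (h : τ ≤ T) :
    ∑ t ∈ Finset.Icc (τ + 1) T,
      ((inner ℝ (p t) (diff y t) : ℝ) + inner ℝ (diff p t) (y (t - 1))) =
      inner ℝ (p T) (y T) - inner ℝ (p τ) (y τ) := by
  induction T, h using Nat.le_induction with
  | base => simp
  | succ T hT ih =>
    rw [Finset.sum_Icc_succ_top (by omega), ih]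
    simp only [diff, Nat.add_sub_cancel, inner_sub_left, inner_sub_right]
    ring

/-- Quantifying over real upper bounds of `φ` keeps later estimates in `ℝ`: the value `⊤` has no
such bound. -/
theorem coe_sub_le_coe_iff {a r : ℝ} {φ : EReal} :
    (a : EReal) - φ ≤ r ↔ ∀ s : ℝ, φ ≤ s → a - s ≤ r := by
  induction φ with
  | bot =>
    simp only [EReal.coe_sub_bot, top_le_iff, EReal.coe_ne_top, bot_le, forall_const, false_iff,
      not_forall, not_le]
    exact ⟨a - r - 1, by linarith⟩
  | top => simp
  | coe b =>
    norm_cast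
    exact ⟨fun h s hs => by linarith, fun h => h b le_rfl⟩

theorem hamiltonian_le_iff {n : ℕ} {L : ℕ → E n → E n → EReal} {t : ℕ} {x p : E n} {r : ℝ} :
    hamiltonian L t x p ≤ r ↔ ∀ v (s : ℝ), L t x v ≤ s → inner ℝ p v - s ≤ r := by
  simp only [hamiltonian, iSup_le_iff, dot, coe_sub_le_coe_iff]

theorem dualLagrangian_le_iff {n : ℕ} {L : ℕ → E n → E n → EReal} {t : ℕ} {p w : E n} {r : ℝ} :
    dualLagrangian L t p w ≤ r ↔
      ∀ x v (s : ℝ), L t x v ≤ s → inner ℝ x w + inner ℝ v p - s ≤ r := by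
  simp only [dualLagrangian, iSup_le_iff, dot, ← EReal.coe_add, coe_sub_le_coe_iff]

theorem dualTerminal_le_iff {n : ℕ} {g : E n → EReal} {b : E n} {r : ℝ} :
    dualTerminal g b ≤ r ↔ ∀ x (s : ℝ), g x ≤ s → - inner ℝ x b - s ≤ r := by
  simp only [dualTerminal, conj, iSup_le_iff, dot, coe_sub_le_coe_iff, inner_neg_right]

theorem exists_coe_ge_of_lt_top {φ : EReal} (h : φ < ⊤) : ∃ s : ℝ, φ ≤ s :=
  let ⟨s, hs, _⟩ := EReal.lt_iff_exists_real_btwn.1 h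
  ⟨s, hs.le⟩

theorem exists_coe_eq {φ : EReal} (hb : ⊥ < φ) (ht : φ < ⊤) : ∃ r : ℝ, φ = r :=
  ⟨φ.toReal, (EReal.coe_toReal ht.ne hb.ne.symm).symm⟩

/-! ### The Hamiltonian inclusion as a joint subgradient of the Lagrangian. -/

/-- `(w, p)` is a subgradient at `(x, v)` of the joint function `F`, which is finite there. -/
def IsJointSubgradient {n : ℕ} (F : E n → E n → EReal) (x v w p : E n) : Prop :=
  ∃ a : ℝ, F x v = a ∧ ∀ y u (s : ℝ), F y u ≤ s →
    a + inner ℝ p (u - v) + inner ℝ w (y - x) ≤ s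

/-- An affine minorant of a joint function, with its slope represented by two vectors. -/
theorem exists_affine_minorant_prod {n : ℕ} {F : E n → E n → EReal}
    (hF : IsProperConvexLsc fun q : E n × E n => F q.1 q.2) (x v : E n) {r : ℝ}
    (hr : (r : EReal) < F x v) :
    ∃ (w p : E n) (c : ℝ), r < inner ℝ w x + inner ℝ p v + c ∧
      ∀ y u (s : ℝ), F y u ≤ s → inner ℝ w y + inner ℝ p u + c ≤ s := by
  obtain ⟨ℓ, c, h1, h2⟩ := hF.exists_affine_minorant (x, v) hr
  obtain ⟨w, hw⟩ := exists_inner_eq (ℓ.toLinearMap.comp (LinearMap.inl ℝ (E n) (E n)))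
  obtain ⟨p, hp⟩ := exists_inner_eq (ℓ.toLinearMap.comp (LinearMap.inr ℝ (E n) (E n)))
  have hℓ : ∀ y u, ℓ (y, u) = inner ℝ w y + inner ℝ p u := by
    intro y u
    rw [← hw, ← hp]
    simp [← map_add]
  refine ⟨w, p, c, ?_, fun y u s hs => ?_⟩
  · rw [← hℓ]
    exact h1
  · rw [← hℓ]
    exact h2 (y, u) s hs

theorem mem_saddleSubdiff_hamiltonian_iff {n : ℕ} {L : ℕ → E n → E n → EReal} {t : ℕ}
    (hL : IsProperConvexLsc fun q : E n × E n => L t q.1 q.2) {x v w p : E n} :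
    (-w, v) ∈ saddleSubdiff (hamiltonian L t) x p ↔ IsJointSubgradient (L t) x v w p := by
  constructor
  · rintro ⟨⟨h1, h2⟩, h3, h4⟩
    simp only [dom, Set.mem_ofPred_eq, neg_neg] at h1 h2 h3 h4
    obtain ⟨h, hh⟩ : ∃ h : ℝ, hamiltonian L t x p = h :=
      exists_coe_eq (by rwa [EReal.neg_lt_comm, EReal.neg_top] at h1) h3
    rw [hh] at h2 h4
    have hle := hamiltonian_le_iff.1 hh.le
    have hval : L t x v ≤ ((inner ℝ p v - h : ℝ) : EReal) := by
      -- Closedness enters here: the slope `q` of an affine minorant exceeding `l` at `(x, v)`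
      -- satisfies `H(x, q) ≤ -c - w' · x`, and the subgradient inequality tested at `q` gives `l ≤
      -- p · v - h`.
      refine EReal.ge_of_forall_gt_iff_ge.1 fun l hl => ?_
      obtain ⟨w', q, c, h5, h6⟩ := exists_affine_minorant_prod hL x v hl
      have h7 : hamiltonian L t x q ≤ ((-c - inner ℝ w' x : ℝ) : EReal) :=
        hamiltonian_le_iff.2 fun u s hs => by linarith [h6 x u s hs]
      have h8 := (h4 q).trans h7
      rw [dot] at h8
      norm_cast at h8 ⊢
      rw [inner_sub_right, real_inner_comm, real_inner_comm p v] at h8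
      linarith
    refine ⟨inner ℝ p v - h, le_antisymm hval ?_, fun y u s hs => ?_⟩
    · refine EReal.le_of_forall_lt_iff_le.1 fun s hs => ?_
      have := hle v s hs.le
      norm_cast
      linarith
    · have h5 : hamiltonian L t y p ≤ ((h - inner ℝ w (y - x) : ℝ) : EReal) := by
        have := EReal.neg_le_neg_iff.2 (h2 y)
        rw [neg_neg, dot] at this
        refine this.trans (le_of_eq ?_)
        norm_cast
        ring
      have := hamiltonian_le_iff.1 h5 u s hs
      rw [inner_sub_right]
      linarith
  · rintro ⟨a, ha, hsub⟩
    have hge : ∀ q, ((inner ℝ q v - a : ℝ) : EReal) ≤ hamiltonian L t x q := by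
      intro q
      refine le_trans (le_of_eq ?_) (le_iSup _ v)
      rw [ha, dot]
      norm_cast
    have hle : ∀ y, hamiltonian L t y p ≤ ((inner ℝ p v - a - inner ℝ w (y - x) : ℝ) : EReal) :=
      fun y => hamiltonian_le_iff.2 fun u s hs => by
        have := hsub y u s hs
        rw [inner_sub_right p] at this
        linarith
    have hh : hamiltonian L t x p = ((inner ℝ p v - a : ℝ) : EReal) :=
      le_antisymm (by simpa using hle x) (hge p)
    refine ⟨⟨?_, fun y => ?_⟩, ?_, fun q => ?_⟩
    · simp only [dom, Set.mem_ofPred_eq, hh, ← EReal.coe_neg]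
      exact EReal.coe_lt_top _
    · have := EReal.neg_le_neg_iff.2 (hle y)
      simp only [hh, neg_neg]
      refine le_trans (le_of_eq ?_) this
      rw [dot]
      norm_cast
      ring
    · simp only [dom, Set.mem_ofPred_eq, hh]
      exact EReal.coe_lt_top _
    · simp only [hh]
      refine le_trans (le_of_eq ?_) (hge q)
      rw [dot, inner_sub_right, real_inner_comm q v, real_inner_comm p v]
      norm_cast
      ring

/-! ### Finite sums and costs in the extended reals. -/

theorem coe_sum {ι : Type*} (s : Finset ι) (a : ι → ℝ) :
    ((∑ i ∈ s, a i : ℝ) : EReal) = ∑ i ∈ s, (a i : EReal) := by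
  classical
  induction s using Finset.induction_on with
  | empty => simp
  | insert i s hi ih => rw [Finset.sum_insert hi, Finset.sum_insert hi, EReal.coe_add, ih]

theorem cost_le_coe {n T : ℕ} {L : ℕ → E n → E n → EReal} {g : E n → EReal} {τ : ℕ}
    {x : ℕ → E n} {a : ℕ → ℝ} {b : ℝ}
    (ha : ∀ t ∈ Finset.Icc (τ + 1) T, L t (x (t - 1)) (diff x t) ≤ a t) (hb : g (x T) ≤ b) :
    cost T L g τ x ≤ ((∑ t ∈ Finset.Icc (τ + 1) T, a t + b : ℝ) : EReal) := by
  rw [EReal.coe_add, cost, coe_sum]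
  exact add_le_add (Finset.sum_le_sum ha) hb

theorem bot_lt_sum {ι : Type*} {s : Finset ι} {φ : ι → EReal} (h : ∀ i ∈ s, ⊥ < φ i) :
    ⊥ < ∑ i ∈ s, φ i := by
  classical
  induction s using Finset.induction_on with
  | empty => simp
  | insert i s hi ih =>
    rw [Finset.sum_insert hi, EReal.bot_lt_add_iff]
    exact ⟨h i (Finset.mem_insert_self i s),
      ih fun j hj => h j (Finset.mem_insert_of_mem hj)⟩

theorem lt_top_of_sum_lt_top {ι : Type*} {s : Finset ι} {φ : ι → EReal}
    (h : ∀ i ∈ s, ⊥ < φ i) (hs : ∑ i ∈ s, φ i < ⊤) : ∀ i ∈ s, φ i < ⊤ := by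
  classical
  intro i hi
  rw [← Finset.add_sum_erase s φ hi] at hs
  have h1 : ⊥ < ∑ j ∈ s.erase i, φ j := bot_lt_sum fun j hj => h j (Finset.mem_of_mem_erase hj)
  exact lt_top_iff_ne_top.2
    ((EReal.add_ne_top_iff_ne_top₂ (h i hi).ne' h1.ne').1 hs.ne).1

theorem exists_real_of_cost_lt_top {n T : ℕ} {L : ℕ → E n → E n → EReal} {g : E n → EReal}
    {τ : ℕ} {x : ℕ → E n} (hL : ∀ t ∈ Finset.Icc (τ + 1) T, ∀ x v, ⊥ < L t x v)
    (hg : ∀ x, ⊥ < g x) (h : cost T L g τ x < ⊤) :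
    ∃ (a : ℕ → ℝ) (b : ℝ), (∀ t ∈ Finset.Icc (τ + 1) T, L t (x (t - 1)) (diff x t) = a t) ∧
      g (x T) = b ∧ cost T L g τ x = ((∑ t ∈ Finset.Icc (τ + 1) T, a t + b : ℝ) : EReal) := by
  have hbot : ⊥ < ∑ t ∈ Finset.Icc (τ + 1) T, L t (x (t - 1)) (diff x t) :=
    bot_lt_sum fun t ht => hL t ht _ _
  have hfin := (EReal.add_ne_top_iff_ne_top₂ hbot.ne' (hg (x T)).ne').1 h.ne
  have hterm := lt_top_of_sum_lt_top (fun t ht => hL t ht _ _) (lt_top_iff_ne_top.2 hfin.1)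
  have ha : ∀ t ∈ Finset.Icc (τ + 1) T, L t (x (t - 1)) (diff x t) =
      ((L t (x (t - 1)) (diff x t)).toReal : EReal) := fun t ht =>
    (EReal.coe_toReal (hterm t ht).ne (hL t ht _ _).ne').symm
  have hb : g (x T) = ((g (x T)).toReal : EReal) :=
    (EReal.coe_toReal hfin.2 (hg _).ne').symm
  refine ⟨fun t => (L t (x (t - 1)) (diff x t)).toReal, (g (x T)).toReal, ha, hb, ?_⟩
  rw [EReal.coe_add, coe_sum, cost, ← hb, Finset.sum_congr rfl ha]

/-- A sum bounded on all termwise strict real minorants is bounded. -/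
theorem sum_le_coe_of_forall_lt {ι : Type*} (s : Finset ι) (φ : ι → EReal) (M : ℝ)
    (h : ∀ l : ι → ℝ, (∀ i ∈ s, (l i : EReal) < φ i) → ∑ i ∈ s, l i ≤ M) :
    ∑ i ∈ s, φ i ≤ M := by
  classical
  induction s using Finset.induction_on generalizing M with
  | empty => simpa using h 0
  | insert i s hi ih =>
    rw [Finset.sum_insert hi]
    have hne : ∀ j ∈ s, j ≠ i := fun j hj hji => hi (hji ▸ hj)
    refine EReal.add_le_of_forall_lt fun a ha b hb => ?_
    obtain ⟨c, hac, hc⟩ := EReal.lt_iff_exists_real_btwn.1 ha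
    have hs := ih (M - c) fun l hl => by
      have := h (Function.update l i c) fun j hj => by
        rcases Finset.mem_insert.1 hj with rfl | hj
        · simpa using hc
        · rw [Function.update_of_ne (hne j hj)]
          exact hl j hj
      rw [Finset.sum_insert hi, Function.update_self,
        Finset.sum_congr rfl fun j hj => Function.update_of_ne (hne j hj) c l] at this
      linarith
    refine (add_le_add hac.le (hb.le.trans hs)).trans (le_of_eq ?_)
    norm_cast
    ring

/-! ### The perturbed problem and its multipliers. -/

theorem relCore.eventually_mem {V : Type*} [AddCommGroup V] [Module ℝ V] {C : Set V}
    (hC : Convex ℝ C) {x y : V} (hx : x ∈ relCore C) (hy : y ∈ C) :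
    ∀ᶠ δ in nhdsWithin (0 : ℝ) (Set.Ioi 0), x + δ • (x - y) ∈ C := by
  obtain ⟨ε, hε, h⟩ := hx.2 y hy
  filter_upwards [Ioc_mem_nhdsGT hε] with δ hδ
  exact relCore_shrink hC hx.1 hδ.1 hδ.2 h

theorem convex_setOf_exists_coe {V : Type*} [AddCommGroup V] [Module ℝ V] {φ : V → EReal}
    (hbot : ∀ x, ⊥ < φ x) (hφ : Convex ℝ (epi φ)) : Convex ℝ {x | ∃ r : ℝ, φ x = r} := by
  intro x hx y hy a b ha hb hab
  obtain ⟨r, hr⟩ := hx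
  obtain ⟨s, hs⟩ := hy
  have := hφ (x := (x, r)) (y := (y, s)) hr.le hs.le ha hb hab
  exact exists_coe_eq (hbot _) (lt_of_le_of_lt this (EReal.coe_lt_top _))

theorem convex_dom {V : Type*} [AddCommGroup V] [Module ℝ V] {φ : V → EReal}
    (hφ : Convex ℝ (epi φ)) : Convex ℝ (dom φ) := by
  intro x hx y hy a b ha hb hab
  obtain ⟨r, hr⟩ := exists_coe_ge_of_lt_top hx
  obtain ⟨s, hs⟩ := exists_coe_ge_of_lt_top hy
  have := hφ (x := (x, r)) (y := (y, s)) hr hs ha hb hab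
  exact lt_of_le_of_lt this (EReal.coe_lt_top _)

/-- The epigraph of the value of the Bolza problem on `[τ : T]` with the linear initial cost
`-η · y_τ`, as a function of an additive perturbation of the velocities. -/
def perturbedEpi {n : ℕ} (T : ℕ) (F : ℕ → E n → E n → EReal) (h : E n → EReal) (τ : ℕ)
    (η : E n) : Set ((ℕ → E n) × ℝ) :=
  {q | ∃ (y : ℕ → E n) (a : ℕ → ℝ) (b : ℝ),
    (∀ t ∈ Finset.Icc (τ + 1) T, F t (y (t - 1)) (diff y t + q.1 t) ≤ a t) ∧ h (y T) ≤ b ∧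
      q.2 = ∑ t ∈ Finset.Icc (τ + 1) T, a t + b - inner ℝ η (y τ)}

theorem convex_perturbedEpi {n T : ℕ} {F : ℕ → E n → E n → EReal} {h : E n → EReal} {τ : ℕ}
    {η : E n} (hF : ∀ t ∈ Finset.Icc (τ + 1) T, Convex ℝ (epi fun q : E n × E n => F t q.1 q.2))
    (hh : Convex ℝ (epi h)) : Convex ℝ (perturbedEpi T F h τ η) := by
  rintro ⟨u, r⟩ ⟨y, a, b, h1, h2, h3⟩ ⟨u', r'⟩ ⟨y', a', b', h1', h2', h3'⟩ α β hα hβ hαβ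
  simp only at h1 h3 h1' h3'
  refine ⟨α • y + β • y', α • a + β • a', α * b + β * b', fun t ht => ?_, ?_, ?_⟩
  · have := hF t ht (x := ((y (t - 1), diff y t + u t), a t))
      (y := ((y' (t - 1), diff y' t + u' t), a' t)) (h1 t ht) (h1' t ht) hα hβ hαβ
    have hd : diff (α • y + β • y') t + (α • u + β • u') t =
        α • (diff y t + u t) + β • (diff y' t + u' t) := by
      simp only [diff, Pi.add_apply, Pi.smul_apply]
      module
    simp only [Prod.smul_mk, Prod.mk_add_mk, hd]
    exact this
  · exact hh (x := (y T, b)) (y := (y' T, b')) h2 h2' hα hβ hαβ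
  · simp only [Prod.smul_mk, Prod.mk_add_mk, smul_eq_mul, h3, h3', Pi.add_apply, Pi.smul_apply,
      Finset.sum_add_distrib, ← Finset.mul_sum, inner_add_right, inner_smul_right]
    ring

/-- The qualified arc `x` realizes the perturbation `0`. If `y` realizes `u`, then `x + δ • (x - y)`
realizes `-δ • u`, with one small `δ` serving all of the finitely many stages. -/
theorem zero_mem_relCore_perturbedEpi {n T : ℕ} {F : ℕ → E n → E n → EReal} {h : E n → EReal}
    (hbot : ∀ t ∈ Finset.Icc 1 T, ∀ x v, ⊥ < F t x v)
    (hF : ∀ t ∈ Finset.Icc 1 T, Convex ℝ (epi fun q : E n × E n => F t q.1 q.2))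
    (hh : Convex ℝ (epi h)) (hq : PrimalQualification T F h) (τ : ℕ) (η : E n) :
    (0 : ℕ → E n) ∈ relCore (Prod.fst '' perturbedEpi T F h τ η) := by
  obtain ⟨x, hxT, hx⟩ := hq
  have hsub : ∀ t ∈ Finset.Icc (τ + 1) T, t ∈ Finset.Icc 1 T := fun t ht => by
    simp only [Finset.mem_Icc] at ht ⊢
    omega
  have hconv : ∀ t ∈ Finset.Icc 1 T, Convex ℝ {q : E n × E n | ∃ r : ℝ, F t q.1 q.2 = r} :=
    fun t ht => convex_setOf_exists_coe (fun q => hbot t ht q.1 q.2) (hF t ht)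
  have hcore : ∀ t ∈ Finset.Icc 1 T,
      (x (t - 1), diff x t) ∈ relCore {q : E n × E n | ∃ r : ℝ, F t q.1 q.2 = r} := fun t ht =>
    mk_mem_relCore (hconv t ht) (intrinsicInterior_subset_relCore _ (hx t ht).1)
      (intrinsicInterior_subset_relCore _ (hx t ht).2)
  have hcoreT : x T ∈ relCore (dom h) := intrinsicInterior_subset_relCore _ hxT
  have build : ∀ (y u : ℕ → E n),
      (∀ t ∈ Finset.Icc (τ + 1) T, ∃ r : ℝ, F t (y (t - 1)) (diff y t + u t) = r) →
      y T ∈ dom h → u ∈ Prod.fst '' perturbedEpi T F h τ η := by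
    intro y u h1 h2
    obtain ⟨b, hb⟩ := exists_coe_ge_of_lt_top h2
    refine ⟨(u, _), ⟨y, fun t => (F t (y (t - 1)) (diff y t + u t)).toReal, b, fun t ht => ?_, hb,
      rfl⟩, rfl⟩
    obtain ⟨r, hr⟩ := h1 t ht
    simp [hr]
  refine ⟨build x 0 (fun t ht => by simpa using (hcore t (hsub t ht)).1) hcoreT.1, ?_⟩
  rintro _ ⟨⟨u, r⟩, ⟨y, a, b, h1, h2, -⟩, rfl⟩
  have hev : ∀ᶠ δ in nhdsWithin (0 : ℝ) (Set.Ioi 0), ∀ t ∈ Finset.Icc (τ + 1) T,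
      (x (t - 1), diff x t) + δ • ((x (t - 1), diff x t) - (y (t - 1), diff y t + u t)) ∈
        {q : E n × E n | ∃ r : ℝ, F t q.1 q.2 = r} :=
    (Finset.eventually_all _).2 fun t ht => relCore.eventually_mem (hconv t (hsub t ht))
      (hcore t (hsub t ht))
      (exists_coe_eq (hbot t (hsub t ht) _ _) ((h1 t ht).trans_lt (EReal.coe_lt_top _)))
  have hevT := relCore.eventually_mem (convex_dom hh) hcoreT
    (show y T ∈ dom h from h2.trans_lt (EReal.coe_lt_top _))
  obtain ⟨δ, ⟨hδ, hδT⟩, hδ0⟩ := ((hev.and hevT).and self_mem_nhdsWithin).exists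
  refine ⟨δ, hδ0, build (x + δ • (x - y)) _ (fun t ht => ?_) hδT⟩
  obtain ⟨r, hr⟩ := hδ t ht
  refine ⟨r, hr ▸ ?_⟩
  congr 1
  simp only [diff, Pi.add_apply, Pi.sub_apply, Pi.smul_apply, Pi.zero_apply, Prod.mk_sub_mk,
    Prod.smul_mk, Prod.mk_add_mk]
  module

/-- Multipliers for the Bolza problem on `[τ : T]` with the linear initial cost `-η · y_τ`: under
the qualification condition, a lower bound for the problem is a lower bound for its Lagrangian,
in which states and velocities are decoupled. -/
theorem exists_multipliers {n T : ℕ} {F : ℕ → E n → E n → EReal} {h : E n → EReal}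
    (hbot : ∀ t ∈ Finset.Icc 1 T, ∀ x v, ⊥ < F t x v)
    (hF : ∀ t ∈ Finset.Icc 1 T, Convex ℝ (epi fun q : E n × E n => F t q.1 q.2))
    (hh : Convex ℝ (epi h)) (hq : PrimalQualification T F h) {τ : ℕ} (hτ : τ ≤ T) (η : E n)
    {m : ℝ} (hm : ∀ (y : ℕ → E n) (a : ℕ → ℝ) (b : ℝ),
      (∀ t ∈ Finset.Icc (τ + 1) T, F t (y (t - 1)) (diff y t) ≤ a t) → h (y T) ≤ b →
        m ≤ ∑ t ∈ Finset.Icc (τ + 1) T, a t + b - inner ℝ η (y τ)) :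
    ∃ p : ℕ → E n, p τ = -η ∧ ∀ (y v : ℕ → E n) (a : ℕ → ℝ) (b : ℝ),
      (∀ t ∈ Finset.Icc (τ + 1) T, F t (y (t - 1)) (v t) ≤ a t) → h (y T) ≤ b →
        m ≤ ∑ t ∈ Finset.Icc (τ + 1) T,
          (a t - inner ℝ (p t) (v t) - inner ℝ (diff p t) (y (t - 1))) + b +
            inner ℝ (p T) (y T) := by
  obtain ⟨ℓ, hℓ⟩ := exists_linear_minorant (m := m)
    (convex_perturbedEpi (τ := τ) (η := η) (fun t ht => hF t (by
      simp only [Finset.mem_Icc] at ht ⊢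
      omega)) hh)
    (zero_mem_relCore_perturbedEpi hbot hF hh hq τ η) (by
      rintro r ⟨y, a, b, h1, h2, h3⟩
      simp only [Pi.zero_apply, add_zero] at h1 h3
      rw [h3]
      exact hm y a b h1 h2)
  choose p hp using fun t => exists_inner_eq (ℓ.comp (LinearMap.single ℝ (fun _ : ℕ => E n) t))
  have hpt : ∀ t ∈ Finset.Icc (τ + 1) T, Function.update p τ (-η) t = p t := fun t ht => by
    rw [Finset.mem_Icc] at ht
    exact Function.update_of_ne (by omega) _ _
  -- The component of `ℓ` at `τ` plays no role; the value `-η` there absorbs the initial cost in the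
  -- summation by parts.
  refine ⟨Function.update p τ (-η), Function.update_self .., fun y v a b ha hb => ?_⟩
  have hsum := sum_inner_diff (Function.update p τ (-η)) y hτ
  rw [Function.update_self, inner_neg_left] at hsum
  -- The perturbation that replaces `Δy` by `v`. Its finite support lets `ℓ u` be computed from the
  -- components `p t`.
  let u : ℕ → E n := ∑ t ∈ Finset.Icc (τ + 1) T, Pi.single t (v t - diff y t)
  have hu : ∀ t ∈ Finset.Icc (τ + 1) T, u t = v t - diff y t := fun t ht => by
    simp only [u, Finset.sum_apply]
    rw [Finset.sum_eq_single_of_mem t ht fun s _ hs => Pi.single_eq_of_ne hs.symm _,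
      Pi.single_eq_same]
  have hℓu : ℓ u = ∑ t ∈ Finset.Icc (τ + 1) T,
      inner ℝ (Function.update p τ (-η) t) (v t - diff y t) := by
    simp only [u, map_sum]
    refine Finset.sum_congr rfl fun t ht => ?_
    rw [hpt t ht, ← hp]
    rfl
  have key := hℓ (u, _) ⟨y, a, b, fun t ht => by
    simp only [hu t ht, add_sub_cancel]
    exact ha t ht, hb, rfl⟩
  simp only [hℓu, inner_sub_right, Finset.sum_sub_distrib] at key
  simp only [Finset.sum_sub_distrib]
  rw [Finset.sum_add_distrib] at hsum
  linarith

/-! ### Sufficiency: trajectories give subgradients. -/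

theorem FullyConvex.lagrangian_of_mem {n T : ℕ} {L : ℕ → E n → E n → EReal} {g : E n → EReal}
    (hA : FullyConvex T L g) {τ t : ℕ} (ht : t ∈ Finset.Icc (τ + 1) T) :
    IsProperConvexLsc (fun q : E n × E n => L t q.1 q.2) :=
  hA.lagrangian t (by
    simp only [Finset.mem_Icc] at ht ⊢
    omega)

theorem FullyConvex.exists_real {n T : ℕ} {L : ℕ → E n → E n → EReal} {g : E n → EReal}
    (hA : FullyConvex T L g) {τ : ℕ} {x : ℕ → E n} (h : cost T L g τ x < ⊤) :
    ∃ (a : ℕ → ℝ) (b : ℝ), (∀ t ∈ Finset.Icc (τ + 1) T, L t (x (t - 1)) (diff x t) = a t) ∧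
      g (x T) = b ∧ cost T L g τ x = ((∑ t ∈ Finset.Icc (τ + 1) T, a t + b : ℝ) : EReal) :=
  exists_real_of_cost_lt_top (fun _ ht x v => (hA.lagrangian_of_mem ht).proper.2 (x, v))
    hA.terminal.proper.2 h

theorem value_le_cost {n T : ℕ} {L : ℕ → E n → E n → EReal} {g : E n → EReal} {τ : ℕ}
    (x : ℕ → E n) : value T L g τ (x τ) ≤ cost T L g τ x :=
  iInf₂_le (f := fun (y : ℕ → E n) (_ : y τ = x τ) => cost T L g τ y) x rfl

/-- The characteristic method: Hamiltonian trajectories carry subgradients of the value. -/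
theorem HasCharacteristic.mem_subdiff_value {n T : ℕ} {L : ℕ → E n → E n → EReal}
    {g : E n → EReal} (hA : FullyConvex T L g) {τ : ℕ} (hτ : τ < T) {ξ η : E n}
    (hc : HasCharacteristic T L g τ ξ η) : η ∈ subdiff (value T L g τ) ξ := by
  obtain ⟨x, p, htraj, rfl, hpτ, hgT, hg⟩ := hc
  have hsub : ∀ t, ∃ a : ℝ, t ∈ Finset.Icc (τ + 1) T → L t (x (t - 1)) (diff x t) = a ∧
      ∀ y u (s : ℝ), L t y u ≤ s →
        a + inner ℝ (p t) (u - diff x t) + inner ℝ (diff p t) (y - x (t - 1)) ≤ s := by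
    intro t
    by_cases ht : t ∈ Finset.Icc (τ + 1) T
    · obtain ⟨a, ha⟩ :=
        (mem_saddleSubdiff_hamiltonian_iff (hA.lagrangian_of_mem ht)).1 (htraj t ht)
      exact ⟨a, fun _ => ha⟩
    · exact ⟨0, fun h => absurd h ht⟩
  choose a ha using hsub
  obtain ⟨b, hb⟩ := exists_coe_eq (hA.terminal.proper.2 (x T)) hgT
  have hle : value T L g τ (x τ) ≤ ((∑ t ∈ Finset.Icc (τ + 1) T, a t + b : ℝ) : EReal) :=
    (value_le_cost x).trans (cost_le_coe (fun t ht => (ha t ht).1.le) hb.le)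
  refine ⟨hle.trans_lt (EReal.coe_lt_top _), fun z => le_iInf₂ ?_⟩
  rintro y rfl
  refine (add_le_add_left hle _).trans ?_
  rcases eq_or_ne (cost T L g τ y) ⊤ with htop | htop
  · rw [htop]
    exact le_top
  obtain ⟨a', b', ha', hb', hcost⟩ := hA.exists_real (lt_top_iff_ne_top.2 htop)
  rw [hcost, dot]
  norm_cast
  have h1 : ∑ t ∈ Finset.Icc (τ + 1) T, (a t + (inner ℝ (p t) (diff (y - x) t) +
      inner ℝ (diff p t) ((y - x) (t - 1)))) ≤ ∑ t ∈ Finset.Icc (τ + 1) T, a' t := by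
    refine Finset.sum_le_sum fun t ht => ?_
    have := (ha t ht).2 _ _ _ (ha' t ht).le
    have hd : diff (y - x) t = diff y t - diff x t := by
      simp only [diff, Pi.sub_apply]
      abel
    rw [hd, Pi.sub_apply]
    linarith
  rw [Finset.sum_add_distrib, sum_inner_diff p (y - x) hτ.le, hpτ] at h1
  have h2 := hg (y T)
  rw [hb, hb', dot] at h2
  norm_cast at h2
  simp only [inner_neg_left, Pi.sub_apply] at h1 h2
  linarith

/-! ### The dual problem and existence of optimal arcs. -/

/-- The dual Lagrangian in the variables of its dynamics. -/
noncomputable def dualStage {n : ℕ} (L : ℕ → E n → E n → EReal) (t : ℕ) (p w : E n) : EReal :=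
  dualLagrangian L t (p + w) w

theorem convex_epi_dualStage {n : ℕ} (L : ℕ → E n → E n → EReal) (t : ℕ) :
    Convex ℝ (epi fun q : E n × E n => dualStage L t q.1 q.2) := by
  rintro ⟨⟨p, w⟩, r⟩ h ⟨⟨p', w'⟩, r'⟩ h' α β hα hβ hαβ
  refine dualLagrangian_le_iff.2 fun x v s hs => ?_
  have h1 := mul_le_mul_of_nonneg_left (dualLagrangian_le_iff.1 h x v s hs) hα
  have h2 := mul_le_mul_of_nonneg_left (dualLagrangian_le_iff.1 h' x v s hs) hβ
  have h3 : s = α * s + β * s := by rw [← add_mul, hαβ, one_mul]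
  simp only [Prod.smul_mk, Prod.mk_add_mk, inner_add_right, inner_smul_right, smul_eq_mul]
    at h1 h2 ⊢
  linarith

theorem bot_lt_dualStage {n : ℕ} {L : ℕ → E n → E n → EReal} {t : ℕ}
    (hL : IsProper fun q : E n × E n => L t q.1 q.2) (p w : E n) : ⊥ < dualStage L t p w := by
  obtain ⟨⟨x, v⟩, hxv⟩ := hL.1
  obtain ⟨s, hs⟩ := exists_coe_ge_of_lt_top hxv
  refine bot_lt_iff_ne_bot.2 fun hK => ?_
  have := dualLagrangian_le_iff.1
    (show dualLagrangian L t (p + w) w ≤ ((inner ℝ x w + inner ℝ v (p + w) - s - 1 : ℝ) : EReal) by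
      rw [show dualLagrangian L t (p + w) w = ⊥ from hK]
      exact bot_le) x v s hs
  linarith

theorem convex_epi_dualTerminal {n : ℕ} (g : E n → EReal) : Convex ℝ (epi (dualTerminal g)) := by
  rintro ⟨p, r⟩ h ⟨p', r'⟩ h' α β hα hβ hαβ
  refine dualTerminal_le_iff.2 fun x s hs => ?_
  have h1 := mul_le_mul_of_nonneg_left (dualTerminal_le_iff.1 h x s hs) hα
  have h2 := mul_le_mul_of_nonneg_left (dualTerminal_le_iff.1 h' x s hs) hβ
  have h3 : s = α * s + β * s := by rw [← add_mul, hαβ, one_mul]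
  simp only [Prod.smul_mk, Prod.mk_add_mk, inner_add_right, inner_smul_right, smul_eq_mul]
    at h1 h2 ⊢
  linarith

/-- The Fenchel–Young inequality at each stage and at the endpoint; after telescoping, the terms
`p_T · x_T` cancel. -/
theorem weak_duality {n T : ℕ} {L : ℕ → E n → E n → EReal} {g : E n → EReal}
    (hA : FullyConvex T L g) {τ : ℕ} (hτ : τ ≤ T) {ξ : E n} {p : ℕ → E n} {a : ℕ → ℝ} {b : ℝ}
    (ha : ∀ t ∈ Finset.Icc (τ + 1) T, dualStage L t (p (t - 1)) (diff p t) ≤ a t)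
    (hb : dualTerminal g (p T) ≤ b) :
    ((-(∑ t ∈ Finset.Icc (τ + 1) T, a t + b + inner ℝ ξ (p τ)) : ℝ) : EReal) ≤
      value T L g τ ξ := by
  refine le_iInf₂ ?_
  rintro x rfl
  rcases eq_or_ne (cost T L g τ x) ⊤ with htop | htop
  · rw [htop]
    exact le_top
  obtain ⟨a', b', ha', hb', hcost⟩ := hA.exists_real (lt_top_iff_ne_top.2 htop)
  rw [hcost, EReal.coe_le_coe_iff]
  have h1 : ∑ t ∈ Finset.Icc (τ + 1) T, (inner ℝ (p t) (diff x t) +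
      inner ℝ (diff p t) (x (t - 1)) - a t) ≤ ∑ t ∈ Finset.Icc (τ + 1) T, a' t := by
    refine Finset.sum_le_sum fun t ht => ?_
    have := dualLagrangian_le_iff.1 (ha t ht) _ _ _ (ha' t ht).le
    have hd : p (t - 1) + diff p t = p t := by simp [diff]
    rw [hd] at this
    rw [real_inner_comm, real_inner_comm (x (t - 1))]
    linarith
  rw [Finset.sum_sub_distrib, sum_inner_diff p x hτ] at h1
  have h2 := dualTerminal_le_iff.1 hb _ _ hb'.le
  rw [real_inner_comm] at h2
  rw [real_inner_comm]
  linarith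

theorem DualQualification.bot_lt_value {n T : ℕ} {L : ℕ → E n → E n → EReal} {g : E n → EReal}
    (hA : FullyConvex T L g) (hq : DualQualification T L g) {τ : ℕ} (hτ : τ ≤ T) (ξ : E n) :
    ⊥ < value T L g τ ξ := by
  obtain ⟨p, hpT, hp⟩ := hq
  have hdom : p T ∈ dom (dualTerminal g) := intrinsicInterior_subset hpT
  obtain ⟨b, hb⟩ := exists_coe_ge_of_lt_top hdom
  refine (EReal.bot_lt_coe _).trans_le (weak_duality hA hτ (p := p) (b := b)
    (a := fun t => (dualStage L t (p (t - 1)) (diff p t)).toReal) (fun t ht => ?_) hb)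
  obtain ⟨r, hr⟩ := intrinsicInterior_subset (hp t (by
    simp only [Finset.mem_Icc] at ht ⊢
    omega)).2
  rw [show dualStage L t (p (t - 1)) (diff p t) = r from hr, EReal.toReal_coe]

/-- Under the dual qualification condition the Bolza problem has an optimal arc. -/
theorem DualQualification.exists_optimal {n T : ℕ} {L : ℕ → E n → E n → EReal} {g : E n → EReal}
    (hA : FullyConvex T L g) (hq : DualQualification T L g) {τ : ℕ} (hτ : τ ≤ T) {ξ : E n}
    {M : ℝ} (hM : value T L g τ ξ = M) :
    ∃ x : ℕ → E n, x τ = ξ ∧ cost T L g τ x ≤ M := by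
  -- Weak duality bounds the dual problem with initial cost `ξ · p_τ` below by `-M`; its multipliers
  -- are the candidate arc, and `η := -ξ` makes it start at `ξ`.
  obtain ⟨x, hxτ, hx⟩ := exists_multipliers (F := dualStage L) (h := dualTerminal g)
    (fun t ht => bot_lt_dualStage (hA.lagrangian t ht).proper)
    (fun t _ => convex_epi_dualStage L t) (convex_epi_dualTerminal g) hq hτ (-ξ) (m := -M)
    (fun p a b ha hb => by
      have := weak_duality (ξ := ξ) hA hτ ha hb
      rw [hM, EReal.coe_le_coe_iff] at this
      rw [inner_neg_left]
      linarith)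
  refine ⟨x, by simpa using hxτ, ?_⟩
  refine EReal.add_le_of_forall_lt fun A hA' B hB => ?_
  obtain ⟨γ, hBγ, hγ⟩ := EReal.lt_iff_exists_real_btwn.1 hB
  have hsum : ∑ t ∈ Finset.Icc (τ + 1) T, L t (x (t - 1)) (diff x t) ≤ ((M - γ : ℝ) : EReal) := by
    refine sum_le_coe_of_forall_lt _ _ _ fun l hl => ?_
    obtain ⟨k', c', hk1, hk2⟩ := hA.terminal.exists_affine_minorant (x T) hγ
    obtain ⟨k, hk⟩ := exists_inner_eq k'.toLinearMap
    simp only [ContinuousLinearMap.coe_coe] at hk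
    simp only [hk] at hk1 hk2
    have hmin : ∀ t, ∃ (w P : E n) (c : ℝ), t ∈ Finset.Icc (τ + 1) T →
        l t < inner ℝ w (x (t - 1)) + inner ℝ P (diff x t) + c ∧
          ∀ y u (s : ℝ), L t y u ≤ s → inner ℝ w y + inner ℝ P u + c ≤ s := by
      intro t
      by_cases ht : t ∈ Finset.Icc (τ + 1) T
      · obtain ⟨w, P, c, h⟩ := exists_affine_minorant_prod (hA.lagrangian_of_mem ht) _ _ (hl t ht)
        exact ⟨w, P, c, fun _ => h⟩
      · exact ⟨0, 0, 0, fun h => absurd h ht⟩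
    choose w P c hwPc using hmin
    -- Slopes of affine minorants serve as dual test points: `p_{t-1} + w_t = P_t` bounds the dual
    -- stage cost by `-c_t`. States and velocities are decoupled in `hx`, so `w_t` need not be
    -- `Δp_t`.
    let p : ℕ → E n := fun s => if s = T then -k else P (s + 1) - w (s + 1)
    have hpT : p T = -k := if_pos rfl
    have hpt : ∀ t ∈ Finset.Icc (τ + 1) T, p (t - 1) = P t - w t := by
      intro t ht
      rw [Finset.mem_Icc] at ht
      have h1 : t - 1 + 1 = t := by omega
      simp only [p, h1]
      exact if_neg (by omega)
    have key := hx p w (fun t => -c t) (-c') (fun t ht => by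
      rw [hpt t ht]
      refine dualLagrangian_le_iff.2 fun y u s hs => ?_
      have := (hwPc t ht).2 y u s hs
      rw [sub_add_cancel, real_inner_comm, real_inner_comm _ u]
      linarith) (by
      rw [hpT]
      refine dualTerminal_le_iff.2 fun y s hs => ?_
      have := hk2 y s hs
      rw [inner_neg_right, real_inner_comm]
      linarith)
    -- Uses `x_t · w_t + Δx_t · (P_t - w_t) = x_{t-1} · w_t + Δx_t · P_t`.
    have hle : ∑ t ∈ Finset.Icc (τ + 1) T, l t ≤ -∑ t ∈ Finset.Icc (τ + 1) T,
        (-c t - inner ℝ (x t) (w t) - inner ℝ (diff x t) (p (t - 1))) := by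
      rw [← Finset.sum_neg_distrib]
      refine Finset.sum_le_sum fun t ht => ?_
      have h1 := (hwPc t ht).1
      rw [hpt t ht]
      simp only [diff, inner_sub_left, inner_sub_right] at h1 ⊢
      simp only [real_inner_comm (x t), real_inner_comm (x (t - 1))] at h1 ⊢
      linarith
    rw [hpT, inner_neg_right, real_inner_comm] at key
    linarith
  refine (add_le_add (hA'.le.trans hsum) hBγ.le).trans (le_of_eq ?_)
  norm_cast
  ring

/-! ### Necessity: subgradients come from trajectories. -/

/-- Under both qualification conditions every subgradient of the value comes from a Hamiltonian
trajectory. -/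
theorem hasCharacteristic_of_mem_subdiff_value {n T : ℕ} {L : ℕ → E n → E n → EReal}
    {g : E n → EReal} (hA : FullyConvex T L g) (hq : PrimalQualification T L g)
    (hq' : DualQualification T L g) {τ : ℕ} (hτ : τ < T) {ξ η : E n}
    (hη : η ∈ subdiff (value T L g τ) ξ) : HasCharacteristic T L g τ ξ η := by
  obtain ⟨M, hM⟩ := exists_coe_eq (hq'.bot_lt_value hA hτ.le ξ) hη.1
  obtain ⟨x, rfl, hx⟩ := hq'.exists_optimal hA hτ.le hM
  obtain ⟨a, b, ha, hb, hcost⟩ := hA.exists_real (hx.trans_lt (EReal.coe_lt_top _))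
  have hMab : M = ∑ t ∈ Finset.Icc (τ + 1) T, a t + b := by
    have := le_antisymm hx (hM ▸ value_le_cost x)
    rw [hcost] at this
    exact_mod_cast this.symm
  -- The subgradient inequality for `η` says that `M - η · ξ` bounds the cost minus `η · y_τ` from
  -- below.
  obtain ⟨p, hpτ, hp⟩ := exists_multipliers
    (fun t ht x v => (hA.lagrangian t ht).proper.2 (x, v))
    (fun t ht => (hA.lagrangian t ht).convex) hA.terminal.convex hq hτ.le η
    (m := M - inner ℝ η (x τ)) (fun y a' b' ha' hb' => by
      have h1 := (hη.2 (y τ)).trans ((value_le_cost y).trans (cost_le_coe ha' hb'))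
      rw [hM, dot, ← EReal.coe_add, EReal.coe_le_coe_iff, inner_sub_right] at h1
      linarith)
  have htel := sum_inner_diff p x hτ.le
  rw [hpτ, inner_neg_left] at htel
  -- The lower bound in `hp` is attained at `(x, Δx)`, so each separate term of the Lagrangian is
  -- minimal there.
  have hopt : M - inner ℝ η (x τ) = ∑ t ∈ Finset.Icc (τ + 1) T,
      (a t - inner ℝ (p t) (diff x t) - inner ℝ (diff p t) (x (t - 1))) + b +
        inner ℝ (p T) (x T) := by
    rw [Finset.sum_add_distrib] at htel
    simp only [Finset.sum_sub_distrib]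
    linarith
  refine ⟨x, p, fun t ht => ?_, rfl, hpτ, hb.trans_lt (EReal.coe_lt_top b), fun z => ?_⟩
  · refine (mem_saddleSubdiff_hamiltonian_iff (hA.lagrangian_of_mem ht)).2
      ⟨a t, ha t ht, fun y u s hs => ?_⟩
    have hne : ∀ r ∈ (Finset.Icc (τ + 1) T).erase t, r ≠ t ∧ r - 1 ≠ t - 1 := by
      intro r hr
      rw [Finset.mem_erase, Finset.mem_Icc] at hr
      rw [Finset.mem_Icc] at ht
      omega
    have hT : T ≠ t - 1 := by
      rw [Finset.mem_Icc] at ht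
      omega
    -- Only the state at `t - 1` and the velocity at `t` vary. No other stage sees them, and `t - 1
    -- < T` leaves the endpoint fixed.
    have key := hp (Function.update x (t - 1) y) (Function.update (diff x) t u)
      (Function.update a t s) b (fun r hr => by
        by_cases hrt : r = t
        · subst hrt
          simpa using hs
        · have := hne r (Finset.mem_erase.2 ⟨hrt, hr⟩)
          rw [Function.update_of_ne this.1, Function.update_of_ne this.1,
            Function.update_of_ne this.2]
          exact (ha r hr).le)
      (by rw [Function.update_of_ne hT]; exact hb.le)
    rw [hopt, ← Finset.add_sum_erase _ _ ht, ← Finset.add_sum_erase _ _ ht,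
      Function.update_of_ne hT] at key
    have hrest : ∑ r ∈ (Finset.Icc (τ + 1) T).erase t, (Function.update a t s r -
        inner ℝ (p r) (Function.update (diff x) t u r) -
        inner ℝ (diff p r) (Function.update x (t - 1) y (r - 1))) =
        ∑ r ∈ (Finset.Icc (τ + 1) T).erase t, (a r - inner ℝ (p r) (diff x r) -
          inner ℝ (diff p r) (x (r - 1))) :=
      Finset.sum_congr rfl fun r hr => by
        rw [Function.update_of_ne (hne r hr).1, Function.update_of_ne (hne r hr).1,
          Function.update_of_ne (hne r hr).2]
    rw [hrest] at key
    simp only [Function.update_self] at key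
    rw [inner_sub_right, inner_sub_right]
    linarith
  · refine EReal.le_of_forall_lt_iff_le.1 fun s hs => ?_
    have hne : ∀ t ∈ Finset.Icc (τ + 1) T, t - 1 ≠ T := by
      intro t ht
      rw [Finset.mem_Icc] at ht
      omega
    -- With velocities decoupled, the state at `T` enters only the terminal terms.
    have key := hp (Function.update x T z) (diff x) a s
      (fun t ht => by rw [Function.update_of_ne (hne t ht)]; exact (ha t ht).le)
      (by rw [Function.update_self]; exact hs.le)
    have hrest : ∑ t ∈ Finset.Icc (τ + 1) T, (a t - inner ℝ (p t) (diff x t) -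
        inner ℝ (diff p t) (Function.update x T z (t - 1))) = ∑ t ∈ Finset.Icc (τ + 1) T,
          (a t - inner ℝ (p t) (diff x t) - inner ℝ (diff p t) (x (t - 1))) :=
      Finset.sum_congr rfl fun t ht => by rw [Function.update_of_ne (hne t ht)]
    rw [hopt, Function.update_self, hrest] at key
    rw [hb, dot, ← EReal.coe_add, EReal.coe_le_coe_iff, inner_neg_left, inner_sub_right]
    linarith

end Bolza

theorem mainTheorem1 (n T : ℕ) (L : ℕ → Bolza.E n → Bolza.E n → EReal)
    (g : Bolza.E n → EReal) (hA : Bolza.FullyConvex T L g)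
    (τ : ℕ) (hτ : τ < T) (ξ η : Bolza.E n) :
    (Bolza.HasCharacteristic T L g τ ξ η → η ∈ Bolza.subdiff (Bolza.value T L g τ) ξ) ∧
    (Bolza.PrimalQualification T L g → Bolza.DualQualification T L g →
      η ∈ Bolza.subdiff (Bolza.value T L g τ) ξ → Bolza.HasCharacteristic T L g τ ξ η) :=
  ⟨fun h => h.mem_subdiff_value hA hτ, fun hq hq' h =>
    Bolza.hasCharacteristic_of_mem_subdiff_value hA hq hq' hτ h⟩
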